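/- Fix $n\ge 1$. An $n$-compartment \emph{linear compartmental model} $M=(G,In,Out,Leak)$ consists of a directed graph $G=(V,E)$ with $V=\{1,\dots,n\}$ and sets $In, Out, Leak\subseteq V$. It has one real parameter $k_{ij}$ for each edge $j\to i$ in $E$ and one real parameter $k_{0j}$ for each $j\in Leak$, so its parameter space is $\mathbb{R}^{|E|+|Leak|}$. Its compartmental matrix $A$ is the $n\times n$ matrix with $A_{ij}=k_{ij}$ if $i\neq j$ and $j\to i\in E$, $A_{ij}=0$ if $i\ne j$ and $j\to i\notin E$, and $A_{ii}=-\epsilon_i-\sum_{p:\, i\to p\in E}k_{pi}$, where $\epsilon_i=k_{0i}$ if $i\in Leak$ and $\epsilon_i=0$ otherwise. The input-output equations of $M$ are, for $i\in Out$, $$\det(\partial I-A)\,y_i=\sum_{j\in In}(-1)^{i+j}\det\big((\partial I-A)_{ji}\big)\,u_j,\qquad \partial=\frac{d}{dt},$$ where $(B)_{ji}$ denotes the matrix $B$ with row $j$ and column $i$ removed. The coefficient map $c:\mathbb{R}^{|E|+|Leak|}\to\mathbb{R}^m$ sends a parameter vector to the vector of the $m$ non-monic coefficients of these equations (the coefficients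 of the derivatives $y_i^{(d)}$ and $u_j^{(d)}$, omitting those that are identically $0$ or identically $1$). For $G$ strongly connected and $In\neq\emptyset$, the model $M$ is \emph{generically locally identifiable} if, outside a set of Lebesgue measure zero, every point of $\mathbb{R}^{|E|+|Leak|}$ has an open neighborhood $U$ such that the restriction $c|_U$ is one-to-one. $M$ is an $n$-compartment \emph{cycle model} if the edges of $G$ are exactly $1\to 2\to\cdots\to n\to 1$. \textbf{Theorem.} Let $n\ge 3$, and let $M=(G,In,Out,Leak)$ be an $n$-compartment cycle model with at least one input ($In\neq\emptyset$), at least one output ($Out\neq\emptyset$), and at most one leak ($|Leak|\le 1$). Then $M$ is generically locally identifiable. -/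

import Mathlib

open MeasureTheory Polynomial

/-- A linear compartmental model with `n` compartments: a directed graph on the compartments,
where `graph.Adj j i` is the edge `j → i`, and the sets of input, output and leak compartments. -/
structure LinearCompartmentalModel (n : ℕ) where
  graph : Digraph (Fin n)
  In : Finset (Fin n)
  Out : Finset (Fin n)
  Leak : Finset (Fin n)

namespace LinearCompartmentalModel

variable {n : ℕ} (M : LinearCompartmentalModel n)

/-- The edges of the model: pairs `(j, i)` such that `j → i` is an edge of the graph. -/
abbrev Edge : Type := {e : Fin n × Fin n // M.graph.Adj e.1 e.2}

noncomputable instance instFintypeEdge : Fintype M.Edge := Fintype.ofFinite _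

/-- The index set of the parameters: one parameter for each edge and one for each leak, so that
`M.Param → ℝ` is the space `ℝ ^ (|E| + |Leak|)`. -/
abbrev Param : Type := M.Edge ⊕ {j : Fin n // j ∈ M.Leak}

open Classical in
/-- The rate constant `k_{ij}` of the edge `j → i` (and `0` if there is no such edge). -/
noncomputable def edgeRate (k : M.Param → ℝ) (i j : Fin n) : ℝ :=
  if h : M.graph.Adj j i then k (Sum.inl ⟨(j, i), h⟩) else 0

/-- The rate constant `k_{0j}` of the leak from compartment `j` (and `0` if `j` has no leak). -/
def leakRate (k : M.Param → ℝ) (j : Fin n) : ℝ :=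
  if h : j ∈ M.Leak then k (Sum.inr ⟨j, h⟩) else 0

/-- The compartmental matrix `A`: off the diagonal, `A i j` is the rate constant `k_{ij}` of the
edge `j → i`; on the diagonal, `A i i` is minus the total rate of outflow (leak and edges) from
compartment `i`. -/
noncomputable def compartmentalMatrix (k : M.Param → ℝ) : Matrix (Fin n) (Fin n) ℝ :=
  fun i j => if i = j then -M.leakRate k i - ∑ p, M.edgeRate k p i else M.edgeRate k i j

end LinearCompartmentalModel

/-- `(-1) ^ (i + j)` times the determinant of the matrix obtained from `B` by removing row `j`
and column `i`. -/
def signedMinor {R : Type*} [CommRing R] :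
    {n : ℕ} → Matrix (Fin n) (Fin n) R → (j i : Fin n) → R
  | 0, _, j, _ => j.elim0
  | _ + 1, B, j, i => (-1) ^ ((i : ℕ) + (j : ℕ)) * (B.submatrix j.succAbove i.succAbove).det

theorem signedMinor_eq_adjugate {R : Type*} [CommRing R] {n : ℕ}
    (B : Matrix (Fin n) (Fin n) R) (j i : Fin n) : signedMinor B j i = B.adjugate i j := by
  cases n with
  | zero => exact j.elim0
  | succ m => rw [Matrix.adjugate_fin_succ_eq_det_submatrix, signedMinor, add_comm (i : ℕ)]

namespace LinearCompartmentalModel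

variable {n : ℕ} (M : LinearCompartmentalModel n)

/-- The matrix `∂I - A`, where the operator `∂ = d/dt` is written as the polynomial variable. -/
noncomputable def diffOpMatrix (k : M.Param → ℝ) : Matrix (Fin n) (Fin n) ℝ[X] :=
  Matrix.diagonal (fun _ => X) - (M.compartmentalMatrix k).map C

/-- The index set of all coefficients of the input-output equations
`det (∂I - A) y_i = ∑_{j ∈ In} (-1) ^ (i + j) det ((∂I - A)_{ji}) u_j`, for `i ∈ Out`:
`inl (i, d)` stands for the coefficient of `y_i^{(d)}` in the equation for `i`, and
`inr (i, j, d)` for the coefficient of `u_j^{(d)}` in the equation for `i`. -/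
abbrev IOIndex : Type :=
  ({i : Fin n // i ∈ M.Out} × Fin (n + 1)) ⊕
    ({i : Fin n // i ∈ M.Out} × {j : Fin n // j ∈ M.In} × Fin n)

/-- The coefficients of the input-output equations, for the parameter vector `k`. -/
noncomputable def ioCoeff (k : M.Param → ℝ) : M.IOIndex → ℝ
  | Sum.inl (_, d) => (M.diffOpMatrix k).det.coeff d
  | Sum.inr (i, j, d) => (signedMinor (M.diffOpMatrix k) j i).coeff d

/-- The indices of the non-monic coefficients that occur in the input-output equations: those
that are not identically `1`, and are not identically `0`, as functions of the parameters. -/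
abbrev NonMonicIndex : Type :=
  {q : M.IOIndex // (∃ k : M.Param → ℝ, M.ioCoeff k q ≠ 1) ∧ ∃ k : M.Param → ℝ, M.ioCoeff k q ≠ 0}

/-- The coefficient map, which sends a vector of parameters to the vector of non-monic
coefficients of the input-output equations. -/
noncomputable def coeffMap (k : M.Param → ℝ) : M.NonMonicIndex → ℝ :=
  fun q => M.ioCoeff k q

/-- Generic local identifiability (a notion used for strongly connected models with at least one
input): outside a set of Lebesgue measure zero, every parameter vector has an open neighborhood
on which the coefficient map is one-to-one. -/
def GenericallyLocallyIdentifiable : Prop :=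
  ∀ᵐ k : M.Param → ℝ ∂volume, ∃ U : Set (M.Param → ℝ),
    IsOpen U ∧ k ∈ U ∧ Set.InjOn M.coeffMap U

/-- A cycle model: the edges of the graph are exactly `1 → 2 → ⋯ → n → 1` (the compartments are
numbered from `0` here). -/
def IsCycleModel : Prop :=
  ∀ j i : Fin n, M.graph.Adj j i ↔ (i : ℕ) = ((j : ℕ) + 1) % n

end LinearCompartmentalModel

/-!
Write `a m` for the rate of the edge `m → m + 1`, and `b m` for the total outflow from `m`, which
is `a m` unless there is a leak at `m`. The determinant of `∂I - A` is `∏ (X + b m) - ∏ a m`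
(`det_cycleMatrix`), and its signed minor for the input `j` and the output `i` is the product of the
rates `a` along the path from `j` to `i` and of the factors `X + b m` for `m` off this path
(`adjugate_cycleMatrix`). The coefficients for a single input `j` and a single output `i` suffice.

It is enough to recover `∏ (X + b m)`. Its roots, which are generically distinct, determine `b`
locally (`eq_of_prod_X_add_C_eq`). Then `a` agrees with `b` except at the leak, and the value at the
leak is found from `∏ a m`, which is known too (`cycleRate_eq_of_outflow_eq`). Now `∏ (X + b m)` is
known up to its constant term.

* If the path from `j` to `i` misses some compartment, then the signed minor reveals a root of
  `∏ (X + b m)`, hence the constant term (`prod_X_add_C_eq_of_common_root`).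
* If the path passes through all compartments, then the signed minor is the constant
  `P = ∏ m ≠ i, a m`. In all cases `∏ b m - b i * P` is then known (`prod_outflow_sub_eq`), so that
  `-b i` is a root of the known polynomial `∏ (X + b m) - P (X + b i)`. It is generically a simple
  root, so `b i` is locally determined, and with it the constant term (`prod_X_add_C_eq_of_root`).

All this is done for two parameter vectors `k`, `k'` with the same coefficients: what is used is that
certain polynomials in `(k, k')` do not vanish (`Separated`). This is an open condition, and it holds
at `(k, k)` for almost every `k`, since each of these polynomials is nonconstant along the lines in
the direction of a suitable rate `a m` (`ae_ne_zero_of_finite_zeros_on_lines`).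
-/

/-! ### The matrix of a weighted cycle -/

section Cycle

open scoped Fin.NatCast Fin.CommRing

variable {R : Type*} [CommRing R] {N : ℕ}

/-- The matrix of a weighted `(N + 1)`-cycle: `x i` on the diagonal, and `-a j` in row `j + 1` of
column `j`. -/
def cycleMatrix (x a : Fin (N + 1) → R) :
    Matrix (Fin (N + 1)) (Fin (N + 1)) R :=
  fun i j => if i = j then x i else if i = j + 1 then -a j else 0

/-- The product of the weights `a` along the path `j → j + 1 → ⋯ → i` in the cycle, times the
product of the weights `x` over the vertices that are not on this path. The vertices are
enumerated as `j + s` with `s ≤ N`, and those with `s ≤ i - j` are on the path. -/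
def pathWeight (x a : Fin (N + 1) → R) (j i : Fin (N + 1)) : R :=
  (∏ s ∈ Finset.range (i - j : Fin (N + 1)).val, a (j + (s : Fin (N + 1)))) *
    ∏ s ∈ Finset.Ico ((i - j : Fin (N + 1)).val + 1) (N + 1), x (j + (s : Fin (N + 1)))

theorem Fin.neg_one_eq_last : (-1 : Fin (N + 1)) = Fin.last N :=
  neg_eq_of_add_eq_zero_left (Fin.last_add_one N)

theorem Fin.prod_range_add_natCast (f : Fin (N + 1) → R) (j : Fin (N + 1)) :
    ∏ s ∈ Finset.range (N + 1), f (j + (s : Fin (N + 1))) = ∏ m, f m := by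
  rw [Finset.prod_range (fun s => f (j + (s : Fin (N + 1))))]
  simp only [Fin.cast_val_eq_self]
  exact Equiv.prod_comp (Equiv.addLeft j) f

theorem Fin.add_one_ne_self (hN : 0 < N) (i : Fin (N + 1)) : i + 1 ≠ i := by
  intro h
  have h1 : (1 : Fin (N + 1)) = 0 := add_eq_left.1 h
  have := Fin.one_eq_zero_iff.1 h1
  omega

theorem Fin.val_sub_one_of_pos {d : Fin (N + 1)} (hd : d ≠ 0) : (d - 1).val + 1 = d.val := by
  rw [Fin.val_sub_one_of_ne_zero hd]
  have : d.val ≠ 0 := Fin.val_ne_zero_iff.2 hd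
  omega

/-- A permutation that moves every vertex of a cycle at most one step forward either fixes every
vertex or is the rotation. -/
theorem Equiv.Perm.eq_one_or_eq_finRotate (hN : 0 < N) (σ : Equiv.Perm (Fin (N + 1)))
    (h : ∀ m, σ m = m ∨ σ m = m + 1) : σ = 1 ∨ σ = finRotate (N + 1) := by
  by_cases h1 : ∀ m, σ m = m
  · left
    ext m
    simp [h1]
  right
  push Not at h1
  obtain ⟨m, hm⟩ := h1
  have key : ∀ s : ℕ, σ (m + (s : Fin (N + 1))) = m + (s : Fin (N + 1)) + 1 := by
    intro s
    induction s with
    | zero => simpa using (h m).resolve_left hm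
    | succ s ih =>
      refine (h _).resolve_left fun h2 => ?_
      have h3 : m + ((s + 1 : ℕ) : Fin (N + 1)) = m + (s : Fin (N + 1)) + 1 := by
        push_cast
        ring
      -- otherwise two consecutive vertices have the same image
      rw [h3, ← ih] at h2
      have h4 := σ.injective h2
      rw [ih] at h4
      exact Fin.add_one_ne_self hN _ h4
  ext i
  have := key (i - m).val
  simp only [Fin.cast_val_eq_self, add_sub_cancel] at this
  rw [this, finRotate_apply]

/-- In the Leibniz expansion only the identity and the rotation contribute. -/
theorem det_cycleMatrix (hN : 0 < N) (x a : Fin (N + 1) → R) :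
    (cycleMatrix x a).det = ∏ m, x m - ∏ m, a m := by
  have hne : (1 : Equiv.Perm (Fin (N + 1))) ≠ finRotate (N + 1) := by
    intro h
    have := Equiv.ext_iff.1 h 0
    rw [finRotate_apply] at this
    exact Fin.add_one_ne_self hN 0 this.symm
  rw [Matrix.det_apply, ← Finset.sum_subset (Finset.subset_univ {1, finRotate (N + 1)})]
  · rw [Finset.sum_pair hne, sign_finRotate]
    simp only [cycleMatrix, finRotate_apply, Fin.add_one_ne_self hN, Equiv.Perm.sign_one,
      Equiv.Perm.one_apply, if_true, if_false, one_smul, Finset.prod_neg, Finset.card_univ,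
      Fintype.card_fin, add_tsub_cancel_right]
    rw [Units.smul_def]
    have : ((-1 : R) ^ N) * (-1) ^ N = 1 := by rw [← mul_pow]; simp
    simp only [zsmul_eq_mul]
    push_cast
    linear_combination -(∏ m, a m) * this
  · intro σ _ hσ
    by_contra h0
    apply hσ
    have h1 : ∀ m, σ m = m ∨ σ m = m + 1 := by
      intro m
      by_contra h2
      push Not at h2
      apply h0
      rw [Finset.prod_eq_zero (Finset.mem_univ m), smul_zero]
      simp [cycleMatrix, h2.1, h2.2]
    simpa using Equiv.Perm.eq_one_or_eq_finRotate hN σ h1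

theorem cycleMatrix_mulVec (hN : 0 < N) (x a v : Fin (N + 1) → R) (i : Fin (N + 1)) :
    (cycleMatrix x a).mulVec v i = x i * v i - a (i - 1) * v (i - 1) := by
  have hne : i ≠ i - 1 := fun h => Fin.add_one_ne_self hN (i - 1) (by simpa using h)
  rw [Matrix.mulVec, dotProduct, ← Finset.sum_subset (Finset.subset_univ {i, i - 1}),
    Finset.sum_pair hne]
  · simp only [cycleMatrix, hne, sub_add_cancel, if_true, if_false]
    ring
  · intro j _ hj
    simp only [Finset.mem_insert, Finset.mem_singleton, not_or] at hj
    have : i ≠ j + 1 := fun h => hj.2 (by simp [h])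
    simp [cycleMatrix, Ne.symm hj.1, this]

/-- Applied to the vector of path weights from `j`, the cycle matrix telescopes along the path:
only the entry at `j`, where the path closes up, survives. -/
theorem cycleMatrix_mulVec_pathWeight (hN : 0 < N) (x a : Fin (N + 1) → R) (j : Fin (N + 1)) :
    (cycleMatrix x a).mulVec (pathWeight x a j) =
      (cycleMatrix x a).det • Pi.single j 1 := by
  ext i
  rw [cycleMatrix_mulVec hN, det_cycleMatrix hN]
  by_cases hij : i = j
  · subst hij
    have h1 : (i - 1 - i : Fin (N + 1)).val = N := by
      have : (i - 1 - i : Fin (N + 1)) = -1 := by ring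
      rw [this, Fin.neg_one_eq_last, Fin.val_last]
    simp only [pathWeight, h1]
    simp only [sub_self, Fin.val_zero, Finset.range_zero, Finset.prod_empty, one_mul, zero_add,
      Finset.Ico_self, mul_one, Pi.smul_apply, Pi.single_eq_same, smul_eq_mul]
    rw [← Fin.prod_range_add_natCast x i, ← Fin.prod_range_add_natCast a i,
      Finset.prod_range_succ (fun s : ℕ => a (i + (s : Fin (N + 1)))), Finset.range_eq_Ico,
      Finset.range_eq_Ico, Finset.prod_eq_prod_Ico_succ_bot (Nat.succ_pos N)]
    have h2 : (i - 1 : Fin (N + 1)) = i + (N : Fin (N + 1)) := by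
      rw [Fin.natCast_eq_last, ← Fin.neg_one_eq_last]
      ring
    rw [h2]
    simp only [Nat.cast_zero, add_zero, zero_add]
    ring
  · have hd : i - j ≠ 0 := sub_ne_zero.2 hij
    have h1 : i - 1 - j = (i - j) - 1 := by ring
    have h2 := Fin.val_sub_one_of_pos hd
    have h3 : j + (((i - j - 1 : Fin (N + 1)).val : ℕ) : Fin (N + 1)) = i - 1 := by
      rw [Fin.cast_val_eq_self]; ring
    have h4 : j + (((i - j : Fin (N + 1)).val : ℕ) : Fin (N + 1)) = i := by
      rw [Fin.cast_val_eq_self]; ring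
    simp only [pathWeight, h1]
    rw [h2, Finset.prod_eq_prod_Ico_succ_bot (i - j).isLt, h4, ← h2, Finset.prod_range_succ, h3]
    simp [hij]
    ring

theorem adjugate_cycleMatrix [IsDomain R] (hN : 0 < N) (x a : Fin (N + 1) → R)
    (hdet : (cycleMatrix x a).det ≠ 0) (j i : Fin (N + 1)) :
    (cycleMatrix x a).adjugate i j = pathWeight x a j i := by
  have h := congrArg (fun v => (cycleMatrix x a).adjugate.mulVec v i)
    (cycleMatrix_mulVec_pathWeight hN x a j)
  simp only [Matrix.mulVec_mulVec, Matrix.adjugate_mul, Matrix.smul_mulVec, Matrix.one_mulVec,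
    Matrix.mulVec_smul, Matrix.mulVec_single_one, Pi.smul_apply, smul_eq_mul, Matrix.col_apply] at h
  exact (mul_left_cancel₀ hdet h).symm

end Cycle

/-! ### Null sets -/

/-- A function whose zeros on every line in a fixed direction are finite in number vanishes on a
null set only. -/
theorem ae_ne_zero_of_finite_zeros_on_lines {E : Type*} [NormedAddCommGroup E] [NormedSpace ℝ E]
    [FiniteDimensional ℝ E] [MeasurableSpace E] [BorelSpace E] (μ : Measure E)
    [μ.IsAddHaarMeasure] {f : E → ℝ} (hf : Continuous f) (v : E)
    (h : ∀ y, {t : ℝ | f (y + t • v) = 0}.Finite) : ∀ᵐ y ∂μ, f y ≠ 0 := by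
  refine ae_mem_of_ae_add_linearMap_mem (LinearMap.toSpanSingleton ℝ E v) volume μ
    (s := {y | f y ≠ 0}) (isOpen_ne_fun hf continuous_const).measurableSet fun y => ?_
  have := (h y).measure_zero volume
  rw [ae_iff]
  simpa using this

/-- For fixed `c` and `P`, the polynomial `∏ (c m - t) - P` in `t`, over at least one factor, has
finitely many roots. -/
theorem finite_setOf_prod_sub_eq {ι : Type*} {s : Finset ι} (hs : s.Nonempty) (c : ι → ℝ) (P : ℝ) :
    {t : ℝ | ∏ m ∈ s, (c m - t) - P = 0}.Finite := by
  have hdeg : (∏ m ∈ s, (C (c m) - X) : ℝ[X]).natDegree = s.card := by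
    rw [natDegree_prod _ _ fun m _ => ?_]
    · have : ∀ m, (C (c m) - X : ℝ[X]).natDegree = 1 := fun m => by
        rw [natDegree_sub, natDegree_X_sub_C]
      simp [this]
    · rw [← neg_sub]
      exact neg_ne_zero.2 (X_sub_C_ne_zero _)
  have hne : (∏ m ∈ s, (C (c m) - X) - C P : ℝ[X]) ≠ 0 := by
    intro h0
    rw [sub_eq_zero] at h0
    rw [h0, natDegree_C] at hdeg
    exact hs.card_pos.ne hdeg
  refine (finite_setOfPred_isRoot hne).subset fun t ht => ?_
  simpa [IsRoot, eval_prod] using ht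

/-! ### Recovering a product of linear factors -/

section Separation

variable {ι : Type*} [Fintype ι]

theorem eval_prod_X_add_C (b : ι → ℝ) (z : ℝ) :
    (∏ m, (X + C (b m)) : ℝ[X]).eval z = ∏ m, (z + b m) := by
  simp [eval_prod]

theorem eq_of_prod_X_add_C_eq {b b' : ι → ℝ}
    (h : (∏ m, (X + C (b m)) : ℝ[X]) = ∏ m, (X + C (b' m)))
    (hsep : ∀ i m, m ≠ i → b m ≠ b' i) : b = b' := by
  ext i
  have h1 := congrArg (eval (-b' i)) h
  rw [eval_prod_X_add_C, eval_prod_X_add_C,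
    Finset.prod_eq_zero (f := fun m => -b' i + b' m) (Finset.mem_univ i) (by ring),
    Finset.prod_eq_zero_iff] at h1
  obtain ⟨m, -, hm⟩ := h1
  have hm' : b m = b' i := by linarith
  by_cases hmi : m = i
  · rw [← hmi, hm', hmi]
  · exact absurd hm' (hsep i m hmi)

/-- If `∏ (X + b m)` and `∏ (X + b' m)` differ by a constant and have a common root, then they
are equal. -/
theorem prod_X_add_C_eq_of_common_root {b b' : ι → ℝ} {c c' z : ℝ}
    (h : (∏ m, (X + C (b m)) : ℝ[X]) - C c = ∏ m, (X + C (b' m)) - C c')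
    (hz : ∏ m, (z + b m) = 0) (hz' : ∏ m, (z + b' m) = 0) :
    (∏ m, (X + C (b m)) : ℝ[X]) = ∏ m, (X + C (b' m)) := by
  have h1 := congrArg (eval z) h
  simp only [eval_sub, eval_prod_X_add_C, hz, hz', eval_C] at h1
  have : c = c' := by linarith
  rw [this] at h
  exact sub_left_injective h

variable [DecidableEq ι]

/-- Suppose that `∏ (X + b m)` is known up to its constant term, and that its constant term `∏ b m`
is known up to a multiple `P` of `b i`. Then `-b i` is a root of the known polynomial
`∏ (X + b m) - P (X + b i)`, and the last hypothesis rules out that `-b' i` is another one. -/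
theorem prod_X_add_C_eq_of_root {b b' : ι → ℝ} {c c' P : ℝ} (i : ι)
    (h : (∏ m, (X + C (b m)) : ℝ[X]) - C c = ∏ m, (X + C (b' m)) - C c')
    (hP : ∏ m, b m - b i * P = ∏ m, b' m - b' i * P)
    (hsep : ∏ m ∈ Finset.univ.erase i, (b m - b' i) ≠ P) :
    (∏ m, (X + C (b m)) : ℝ[X]) = ∏ m, (X + C (b' m)) := by
  have h0 := congrArg (eval 0) h
  have h1 := congrArg (eval (-b' i)) h
  simp only [eval_sub, eval_prod_X_add_C, eval_C, zero_add] at h0 h1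
  rw [Finset.prod_eq_zero (f := fun m => -b' i + b' m) (Finset.mem_univ i) (by ring),
    ← Finset.mul_prod_erase _ _ (Finset.mem_univ i)] at h1
  have h2 : ∏ m ∈ Finset.univ.erase i, (-b' i + b m) =
      ∏ m ∈ Finset.univ.erase i, (b m - b' i) :=
    Finset.prod_congr rfl fun m _ => by ring
  rw [h2] at h1
  have h3 : (b i - b' i) * (∏ m ∈ Finset.univ.erase i, (b m - b' i) - P) = 0 := by
    linear_combination h1 - h0 + hP
  have h4 : b i = b' i := by
    rcases mul_eq_zero.1 h3 with h4 | h4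
    · linarith
    · exact absurd (sub_eq_zero.1 h4) hsep
  have h5 : c = c' := by
    rw [h4] at hP
    linarith
  rw [h5] at h
  exact sub_left_injective h

end Separation

namespace LinearCompartmentalModel

section CycleModel

variable {N : ℕ} (M : LinearCompartmentalModel (N + 1))

/-! ### Rates and outflows in a cycle model -/

/-- The rate constant of the edge out of compartment `m` in a cycle model. -/
noncomputable def cycleRate (k : M.Param → ℝ) (m : Fin (N + 1)) : ℝ := M.edgeRate k (m + 1) m

/-- The total rate of outflow from compartment `m` in a cycle model. -/
noncomputable def outflow (k : M.Param → ℝ) (m : Fin (N + 1)) : ℝ :=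
  M.cycleRate k m + M.leakRate k m

theorem outflow_eq_cycleRate {M : LinearCompartmentalModel (N + 1)} {m : Fin (N + 1)}
    (hm : m ∉ M.Leak) (k : M.Param → ℝ) : M.outflow k m = M.cycleRate k m := by
  simp [outflow, leakRate, hm]

theorem continuous_cycleRate (m : Fin (N + 1)) : Continuous fun k => M.cycleRate k m := by
  unfold cycleRate edgeRate
  split_ifs <;> fun_prop

theorem continuous_leakRate (m : Fin (N + 1)) : Continuous fun k => M.leakRate k m := by
  unfold leakRate
  split_ifs <;> fun_prop

theorem continuous_outflow (m : Fin (N + 1)) : Continuous fun k => M.outflow k m :=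
  (M.continuous_cycleRate m).add (M.continuous_leakRate m)

variable {M}

theorem IsCycleModel.adj_iff (hM : M.IsCycleModel) (j i : Fin (N + 1)) :
    M.graph.Adj j i ↔ i = j + 1 := by
  rw [hM, Fin.ext_iff, Fin.val_add, Fin.val_one', Nat.add_mod_mod]

theorem IsCycleModel.edgeRate_eq (hM : M.IsCycleModel) (k : M.Param → ℝ) (i j : Fin (N + 1)) :
    M.edgeRate k i j = if i = j + 1 then M.cycleRate k j else 0 := by
  split_ifs with h
  · rw [h, cycleRate]
  · exact dif_neg fun h' => h ((hM.adj_iff j i).1 h')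

theorem IsCycleModel.ext_param (hM : M.IsCycleModel) {k k' : M.Param → ℝ}
    (ha : M.cycleRate k = M.cycleRate k') (hb : M.outflow k = M.outflow k') : k = k' := by
  ext p
  rcases p with ⟨⟨j, i⟩, h⟩ | ⟨j, hj⟩
  · obtain rfl := (hM.adj_iff j i).1 h
    have h1 := congrFun ha j
    simpa only [cycleRate, edgeRate, dif_pos h] using h1
  · have h1 := congrFun ha j
    have h2 := congrFun hb j
    simp only [outflow, h1, add_right_inj] at h2
    simpa only [leakRate, dif_pos hj] using h2

/-! ### The input-output equations of a cycle model -/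

theorem IsCycleModel.diffOpMatrix_eq (hM : M.IsCycleModel) (k : M.Param → ℝ) :
    M.diffOpMatrix k =
      cycleMatrix (fun m => X + C (M.outflow k m)) (fun m => C (M.cycleRate k m)) := by
  ext1 i j
  simp only [diffOpMatrix, Matrix.sub_apply, Matrix.map_apply, compartmentalMatrix, cycleMatrix]
  by_cases hij : i = j
  · subst hij
    simp only [hM.edgeRate_eq, Finset.sum_ite_eq', Finset.mem_univ, if_true, Matrix.diagonal_apply,
      outflow, C_add, C_sub, C_neg]
    ring
  · simp only [hij, if_false, Matrix.diagonal_apply_ne _ hij, hM.edgeRate_eq]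
    split_ifs <;> simp

theorem IsCycleModel.det_diffOpMatrix (hN : 0 < N) (hM : M.IsCycleModel) (k : M.Param → ℝ) :
    (M.diffOpMatrix k).det =
      ∏ m, (X + C (M.outflow k m)) - C (∏ m, M.cycleRate k m) := by
  rw [hM.diffOpMatrix_eq, det_cycleMatrix hN, map_prod]

theorem det_diffOpMatrix_monic (k : M.Param → ℝ) : (M.diffOpMatrix k).det.Monic :=
  Matrix.charpoly_monic (M.compartmentalMatrix k)

theorem natDegree_det_diffOpMatrix (k : M.Param → ℝ) :
    (M.diffOpMatrix k).det.natDegree = N + 1 :=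
  (Matrix.charpoly_natDegree_eq_dim (M.compartmentalMatrix k)).trans (Fintype.card_fin _)

theorem IsCycleModel.signedMinor_diffOpMatrix (hN : 0 < N) (hM : M.IsCycleModel)
    (k : M.Param → ℝ) (j i : Fin (N + 1)) :
    signedMinor (M.diffOpMatrix k) j i =
      pathWeight (fun m => X + C (M.outflow k m)) (fun m => C (M.cycleRate k m)) j i := by
  have hdet := (M.det_diffOpMatrix_monic k).ne_zero
  rw [hM.diffOpMatrix_eq] at hdet
  rw [signedMinor_eq_adjugate, hM.diffOpMatrix_eq, adjugate_cycleMatrix hN _ _ hdet]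

theorem natDegree_pathWeight_le (b a : Fin (N + 1) → ℝ) (j i : Fin (N + 1)) :
    (pathWeight (fun m => X + C (b m)) (fun m => C (a m)) j i).natDegree ≤ N := by
  refine natDegree_mul_le.trans ?_
  rw [← map_prod, natDegree_C, zero_add]
  refine (natDegree_prod_le _ _).trans ?_
  simp

/-- The coefficients that are identically `0` or `1`, which the coefficient map omits, carry no
information. -/
theorem ioCoeff_eq_of_coeffMap_eq {k k' : M.Param → ℝ} (h : M.coeffMap k = M.coeffMap k')
    (q : M.IOIndex) : M.ioCoeff k q = M.ioCoeff k' q := by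
  by_cases h1 : ∃ k, M.ioCoeff k q ≠ 1
  · by_cases h0 : ∃ k, M.ioCoeff k q ≠ 0
    · exact congrFun h ⟨q, h1, h0⟩
    · push Not at h0
      rw [h0, h0]
  · push Not at h1
    rw [h1, h1]

theorem det_eq_of_coeffMap_eq (hOut : M.Out.Nonempty) {k k' : M.Param → ℝ}
    (h : M.coeffMap k = M.coeffMap k') : (M.diffOpMatrix k).det = (M.diffOpMatrix k').det := by
  obtain ⟨i, hi⟩ := hOut
  ext d
  by_cases hd : d < N + 2
  · exact ioCoeff_eq_of_coeffMap_eq h (Sum.inl (⟨i, hi⟩, ⟨d, hd⟩))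
  · rw [coeff_eq_zero_of_natDegree_lt, coeff_eq_zero_of_natDegree_lt] <;>
      rw [natDegree_det_diffOpMatrix] <;> omega

theorem IsCycleModel.pathWeight_eq_of_coeffMap_eq (hN : 0 < N) (hM : M.IsCycleModel)
    {k k' : M.Param → ℝ} (h : M.coeffMap k = M.coeffMap k') {i j : Fin (N + 1)} (hi : i ∈ M.Out)
    (hj : j ∈ M.In) :
    pathWeight (fun m => X + C (M.outflow k m)) (fun m => C (M.cycleRate k m)) j i =
      pathWeight (fun m => X + C (M.outflow k' m)) (fun m => C (M.cycleRate k' m)) j i := by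
  ext d
  by_cases hd : d < N + 1
  · have h1 := ioCoeff_eq_of_coeffMap_eq h (Sum.inr (⟨i, hi⟩, ⟨j, hj⟩, ⟨d, hd⟩))
    simpa only [ioCoeff, hM.signedMinor_diffOpMatrix hN] using h1
  · rw [coeff_eq_zero_of_natDegree_lt, coeff_eq_zero_of_natDegree_lt] <;>
      exact (natDegree_pathWeight_le _ _ _ _).trans_lt (by omega)

/-! ### Generic parameters -/

/-- Conditions on two parameter vectors under which they are equal as soon as their coefficients
are; see `IsCycleModel.eq_of_coeffMap_eq`. They are open, and hold for almost every parameter vector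
paired with itself. -/
structure Separated (M : LinearCompartmentalModel (N + 1)) (k k' : M.Param → ℝ) : Prop where
  outflow_ne : ∀ i m, m ≠ i → M.outflow k m ≠ M.outflow k' i
  prod_ne : ∀ i, ∏ m ∈ Finset.univ.erase i, (M.outflow k m - M.outflow k' i) ≠
    ∏ m ∈ Finset.univ.erase i, M.cycleRate k m
  left_ne_zero : ∀ m, M.cycleRate k m ≠ 0
  right_ne_zero : ∀ m, M.cycleRate k' m ≠ 0

theorem Separated.eventually {k : M.Param → ℝ} (h : M.Separated k k) :
    ∀ᶠ p : (M.Param → ℝ) × (M.Param → ℝ) in nhds (k, k), M.Separated p.1 p.2 := by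
  have ha1 : ∀ m, Continuous fun p : (M.Param → ℝ) × (M.Param → ℝ) => M.cycleRate p.1 m :=
    fun m => (M.continuous_cycleRate m).comp continuous_fst
  have ha2 : ∀ m, Continuous fun p : (M.Param → ℝ) × (M.Param → ℝ) => M.cycleRate p.2 m :=
    fun m => (M.continuous_cycleRate m).comp continuous_snd
  have hb1 : ∀ m, Continuous fun p : (M.Param → ℝ) × (M.Param → ℝ) => M.outflow p.1 m :=
    fun m => (M.continuous_outflow m).comp continuous_fst
  have hb2 : ∀ m, Continuous fun p : (M.Param → ℝ) × (M.Param → ℝ) => M.outflow p.2 m :=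
    fun m => (M.continuous_outflow m).comp continuous_snd
  have h1 : ∀ᶠ p : (M.Param → ℝ) × (M.Param → ℝ) in nhds (k, k),
      ∀ i m, m ≠ i → M.outflow p.1 m ≠ M.outflow p.2 i := by
    simp only [Filter.eventually_all]
    exact fun i m hmi => (isOpen_ne_fun (hb1 m) (hb2 i)).mem_nhds (h.outflow_ne i m hmi)
  have h2 : ∀ᶠ p : (M.Param → ℝ) × (M.Param → ℝ) in nhds (k, k),
      ∀ i, ∏ m ∈ Finset.univ.erase i, (M.outflow p.1 m - M.outflow p.2 i) ≠
        ∏ m ∈ Finset.univ.erase i, M.cycleRate p.1 m := by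
    rw [Filter.eventually_all]
    exact fun i => (isOpen_ne_fun (continuous_finsetProd _ fun m _ => (hb1 m).sub (hb2 i))
      (continuous_finsetProd _ fun m _ => ha1 m)).mem_nhds (h.prod_ne i)
  have h3 : ∀ᶠ p : (M.Param → ℝ) × (M.Param → ℝ) in nhds (k, k), ∀ m, M.cycleRate p.1 m ≠ 0 := by
    rw [Filter.eventually_all]
    exact fun m => (isOpen_ne_fun (ha1 m) continuous_const).mem_nhds (h.left_ne_zero m)
  have h4 : ∀ᶠ p : (M.Param → ℝ) × (M.Param → ℝ) in nhds (k, k), ∀ m, M.cycleRate p.2 m ≠ 0 := by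
    rw [Filter.eventually_all]
    exact fun m => (isOpen_ne_fun (ha2 m) continuous_const).mem_nhds (h.right_ne_zero m)
  filter_upwards [h1, h2, h3, h4] with p h1 h2 h3 h4 using ⟨h1, h2, h3, h4⟩

/-- The direction in the parameter space in which only the rate of the edge out of compartment `m`
changes. -/
noncomputable def rateDirection (hM : M.IsCycleModel) (m : Fin (N + 1)) : M.Param → ℝ :=
  Pi.single (Sum.inl ⟨(m, m + 1), (hM.adj_iff m (m + 1)).2 rfl⟩) 1

theorem cycleRate_add_smul_rateDirection (hM : M.IsCycleModel) (k : M.Param → ℝ) (t : ℝ)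
    (m i : Fin (N + 1)) :
    M.cycleRate (k + t • rateDirection hM m) i = M.cycleRate k i + if i = m then t else 0 := by
  have h := (hM.adj_iff i (i + 1)).2 rfl
  simp only [cycleRate, edgeRate, dif_pos h, rateDirection, Pi.add_apply, Pi.smul_apply,
    smul_eq_mul]
  by_cases him : i = m
  · subst him
    simp
  · simp [him]

theorem outflow_add_smul_rateDirection (hM : M.IsCycleModel) (k : M.Param → ℝ) (t : ℝ)
    (m i : Fin (N + 1)) :
    M.outflow (k + t • rateDirection hM m) i = M.outflow k i + if i = m then t else 0 := by
  have : M.leakRate (k + t • rateDirection hM m) i = M.leakRate k i := by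
    simp [leakRate, rateDirection]
  rw [outflow, outflow, cycleRate_add_smul_rateDirection, this]
  ring

theorem IsCycleModel.ae_separated (hN : 0 < N) (hM : M.IsCycleModel) :
    ∀ᵐ k : M.Param → ℝ, M.Separated k k := by
  have h1 : ∀ i m, ∀ᵐ k : M.Param → ℝ, m ≠ i → M.outflow k m - M.outflow k i ≠ 0 := by
    intro i m
    by_cases hmi : m = i
    · simp [hmi]
    have := ae_ne_zero_of_finite_zeros_on_lines (volume : Measure (M.Param → ℝ))
      ((M.continuous_outflow m).sub (M.continuous_outflow i)) (rateDirection hM m) fun k => by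
        refine (Set.finite_singleton (M.outflow k i - M.outflow k m)).subset fun t ht => ?_
        simp only [Set.mem_ofPred_eq, Pi.sub_apply, outflow_add_smul_rateDirection, if_true,
          Ne.symm hmi, if_false] at ht
        rw [Set.mem_singleton_iff]
        linarith
    filter_upwards [this] with k hk _ using hk
  have h2 : ∀ i, ∀ᵐ k : M.Param → ℝ,
      ∏ m ∈ Finset.univ.erase i, (M.outflow k m - M.outflow k i) -
        ∏ m ∈ Finset.univ.erase i, M.cycleRate k m ≠ 0 := by
    intro i
    refine ae_ne_zero_of_finite_zeros_on_lines volume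
      ((continuous_finsetProd _ fun m _ =>
        (M.continuous_outflow m).sub (M.continuous_outflow i)).sub
        (continuous_finsetProd _ fun m _ => M.continuous_cycleRate m)) (rateDirection hM i)
        fun k => ?_
    have hs : (Finset.univ.erase i).Nonempty :=
      ⟨i + 1, Finset.mem_erase.2 ⟨Fin.add_one_ne_self hN i, Finset.mem_univ _⟩⟩
    refine (finite_setOf_prod_sub_eq hs (fun m => M.outflow k m - M.outflow k i)
      (∏ m ∈ Finset.univ.erase i, M.cycleRate k m)).subset fun t ht => ?_
    simp only [Set.mem_ofPred_eq, outflow_add_smul_rateDirection,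
      cycleRate_add_smul_rateDirection] at ht ⊢
    rw [← ht]
    congr 1 <;> refine Finset.prod_congr rfl fun m hm => ?_ <;>
      simp only [Finset.ne_of_mem_erase hm, if_true, if_false] <;> ring
  have h3 : ∀ m, ∀ᵐ k : M.Param → ℝ, M.cycleRate k m ≠ 0 := by
    intro m
    refine ae_ne_zero_of_finite_zeros_on_lines volume (M.continuous_cycleRate m)
      (rateDirection hM m) fun k => ?_
    refine (Set.finite_singleton (-M.cycleRate k m)).subset fun t ht => ?_
    simp only [Set.mem_ofPred_eq, cycleRate_add_smul_rateDirection, if_true] at ht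
    rw [Set.mem_singleton_iff]
    linarith
  filter_upwards [ae_all_iff.2 fun i => ae_all_iff.2 (h1 i), ae_all_iff.2 h2, ae_all_iff.2 h3]
    with k h1 h2 h3
  exact ⟨fun i m hmi => sub_ne_zero.1 (h1 i m hmi), fun i => sub_ne_zero.1 (h2 i), h3, h3⟩

/-! ### Injectivity of the coefficient map -/

open scoped Fin.NatCast Fin.CommRing in
/-- If some compartment is not on the path from the input `j` to the output `i`, then the
compartment `j - 1 = j + N` is not, and minus its outflow is a common root of `∏ (X + b m)` and
`∏ (X + b' m)`. -/
theorem exists_common_root_of_pathWeight_eq {a b a' b' : Fin (N + 1) → ℝ} (ha' : ∀ m, a' m ≠ 0)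
    {i j : Fin (N + 1)} (hij : (i - j).val < N)
    (h : pathWeight (fun m => X + C (b m)) (fun m => C (a m)) j i =
      pathWeight (fun m => X + C (b' m)) (fun m => C (a' m)) j i) :
    ∃ z, ∏ m, (z + b m) = 0 ∧ ∏ m, (z + b' m) = 0 := by
  refine ⟨-b (j + (N : Fin (N + 1))), Finset.prod_eq_zero (Finset.mem_univ _) (by ring), ?_⟩
  have h1 := congrArg (eval (-b (j + (N : Fin (N + 1))))) h
  simp only [pathWeight, eval_mul, eval_prod, eval_add, eval_X, eval_C] at h1
  rw [Finset.prod_eq_zero (i := N) (s := Finset.Ico _ _) (Finset.mem_Ico.2 ⟨hij, N.lt_succ_self⟩)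
    (by ring), mul_zero, eq_comm, mul_eq_zero, or_iff_right
    (Finset.prod_ne_zero_iff.2 fun s _ => ha' _), Finset.prod_eq_zero_iff] at h1
  obtain ⟨s, -, hs⟩ := h1
  exact Finset.prod_eq_zero (Finset.mem_univ _) hs

open scoped Fin.NatCast Fin.CommRing in
theorem pathWeight_of_val_eq {a : Fin (N + 1) → ℝ} {i j : Fin (N + 1)} (ha : a i ≠ 0)
    (hij : (i - j).val = N) (x : Fin (N + 1) → ℝ[X]) :
    pathWeight x (fun m => C (a m)) j i = C (∏ m ∈ Finset.univ.erase i, a m) := by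
  have hi : j + (N : Fin (N + 1)) = i := by
    have h := Fin.cast_val_eq_self (i - j)
    rw [hij] at h
    rw [h]
    ring
  rw [pathWeight, hij, Finset.Ico_self, Finset.prod_empty, mul_one, ← map_prod]
  refine congrArg C (mul_right_cancel₀ ha ?_)
  rw [Finset.prod_erase_mul _ _ (Finset.mem_univ i), ← Fin.prod_range_add_natCast a j,
    Finset.prod_range_succ, hi]

/-- The quantity `∏ m, outflow m - outflow i * ∏ m ≠ i, cycleRate m` can be read off from the
constant term of the determinant and from `∏ m ≠ i, cycleRate m`: if there is no leak at `i`, it is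
the constant term, and if the leak is at `i`, it is `0`, as the other outflows are rates. -/
theorem prod_outflow_sub_eq (hLeak : M.Leak.card ≤ 1) {k k' : M.Param → ℝ} (i : Fin (N + 1))
    (hdet : ∏ m, M.outflow k m - ∏ m, M.cycleRate k m =
      ∏ m, M.outflow k' m - ∏ m, M.cycleRate k' m)
    (hP : ∏ m ∈ Finset.univ.erase i, M.cycleRate k m =
      ∏ m ∈ Finset.univ.erase i, M.cycleRate k' m) :
    ∏ m, M.outflow k m - M.outflow k i * ∏ m ∈ Finset.univ.erase i, M.cycleRate k m =
      ∏ m, M.outflow k' m - M.outflow k' i * ∏ m ∈ Finset.univ.erase i, M.cycleRate k m := by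
  by_cases hi : i ∈ M.Leak
  · have h : ∀ k : M.Param → ℝ, ∏ m, M.outflow k m =
        M.outflow k i * ∏ m ∈ Finset.univ.erase i, M.cycleRate k m := by
      intro k
      rw [← Finset.mul_prod_erase _ _ (Finset.mem_univ i)]
      refine congrArg _ (Finset.prod_congr rfl fun m hm => outflow_eq_cycleRate (fun hm' => ?_) k)
      exact Finset.ne_of_mem_erase hm (Finset.card_le_one.1 hLeak m hm' i hi)
    rw [h k, h k', hP]
    ring
  · rw [← Finset.mul_prod_erase _ (M.cycleRate k) (Finset.mem_univ i),
      ← Finset.mul_prod_erase _ (M.cycleRate k') (Finset.mem_univ i), ← hP] at hdet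
    rwa [outflow_eq_cycleRate hi, outflow_eq_cycleRate hi]

theorem cycleRate_eq_of_outflow_eq (hLeak : M.Leak.card ≤ 1) {k k' : M.Param → ℝ}
    (hb : M.outflow k = M.outflow k') (ha : ∏ m, M.cycleRate k m = ∏ m, M.cycleRate k' m)
    (ha0 : ∀ m, M.cycleRate k m ≠ 0) : M.cycleRate k = M.cycleRate k' := by
  have h : ∀ m, m ∉ M.Leak → M.cycleRate k m = M.cycleRate k' m := fun m hm => by
    rw [← outflow_eq_cycleRate hm, ← outflow_eq_cycleRate hm, hb]
  ext i
  by_cases hi : i ∈ M.Leak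
  · have h1 : ∏ m ∈ Finset.univ.erase i, M.cycleRate k m =
        ∏ m ∈ Finset.univ.erase i, M.cycleRate k' m :=
      Finset.prod_congr rfl fun m hm => h m fun hm' =>
        Finset.ne_of_mem_erase hm (Finset.card_le_one.1 hLeak m hm' i hi)
    rw [← Finset.mul_prod_erase _ _ (Finset.mem_univ i),
      ← Finset.mul_prod_erase _ (M.cycleRate k') (Finset.mem_univ i), ← h1] at ha
    exact mul_right_cancel₀ (Finset.prod_ne_zero_iff.2 fun m _ => ha0 m) ha
  · exact h i hi

theorem IsCycleModel.eq_of_coeffMap_eq (hN : 0 < N) (hM : M.IsCycleModel) (hIn : M.In.Nonempty)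
    (hOut : M.Out.Nonempty) (hLeak : M.Leak.card ≤ 1) {k k' : M.Param → ℝ}
    (hsep : M.Separated k k') (h : M.coeffMap k = M.coeffMap k') : k = k' := by
  have hdet := det_eq_of_coeffMap_eq hOut h
  rw [hM.det_diffOpMatrix hN, hM.det_diffOpMatrix hN] at hdet
  have hdet0 : ∏ m, M.outflow k m - ∏ m, M.cycleRate k m =
      ∏ m, M.outflow k' m - ∏ m, M.cycleRate k' m := by
    simpa only [eval_sub, eval_prod_X_add_C, eval_C, zero_add] using congrArg (eval 0) hdet
  obtain ⟨j, hj⟩ := hIn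
  obtain ⟨i, hi⟩ := hOut
  have hpath := hM.pathWeight_eq_of_coeffMap_eq hN h hi hj
  have hprod : (∏ m, (X + C (M.outflow k m)) : ℝ[X]) = ∏ m, (X + C (M.outflow k' m)) := by
    rcases (Nat.lt_succ_iff.1 (i - j).isLt).lt_or_eq with hij | hij
    · obtain ⟨z, hz, hz'⟩ := exists_common_root_of_pathWeight_eq hsep.right_ne_zero hij hpath
      exact prod_X_add_C_eq_of_common_root hdet hz hz'
    · rw [pathWeight_of_val_eq (hsep.left_ne_zero i) hij,
        pathWeight_of_val_eq (hsep.right_ne_zero i) hij] at hpath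
      exact prod_X_add_C_eq_of_root i hdet (prod_outflow_sub_eq hLeak i hdet0 (C_injective hpath))
        (hsep.prod_ne i)
  have hb : M.outflow k = M.outflow k' := eq_of_prod_X_add_C_eq hprod hsep.outflow_ne
  refine hM.ext_param (cycleRate_eq_of_outflow_eq hLeak hb ?_ hsep.left_ne_zero) hb
  rw [hb] at hdet0
  linarith

end CycleModel

end LinearCompartmentalModel

theorem mainTheorem1 (n : ℕ) (hn : 3 ≤ n) (M : LinearCompartmentalModel n)
    (hM : M.IsCycleModel) (hIn : M.In.Nonempty) (hOut : M.Out.Nonempty)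
    (hLeak : M.Leak.card ≤ 1) :
    M.GenericallyLocallyIdentifiable := by
  obtain ⟨N, rfl⟩ : ∃ N, n = N + 1 := ⟨n - 1, by omega⟩
  have hN : 0 < N := by omega
  filter_upwards [hM.ae_separated hN] with k hk
  obtain ⟨U, V, hU, hkU, hV, hkV, hUV⟩ := mem_nhds_prod_iff'.1 hk.eventually
  refine ⟨U ∩ V, hU.inter hV, ⟨hkU, hkV⟩, fun p hp p' hp' h => ?_⟩
  exact hM.eq_of_coeffMap_eq hN hIn hOut hLeak (hUV (Set.mk_mem_prod hp.1 hp'.2)) h
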